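/- Let $q$ be a prime power and let $n\ge 1$ be an integer with $q\ge n$. Write the points of $\mathrm{PG}(2,q^n)$ as $(a,b,c)_{\mathbb F_{q^n}}$ with $a,b,c\in\mathbb F_{q^n}$ not all zero, and the points of $\mathrm{PG}(2n,q)$ as $(a,b,c)_{\mathbb F_q}$ with $a,b\in\mathbb F_{q^n}$, $c\in\mathbb F_q$ not all zero. Let $l_\infty$ be the line $c=0$ of $\mathrm{PG}(2,q^n)$ and $H_\infty$ the hyperplane $c=0$ of $\mathrm{PG}(2n,q)$; points of $\mathrm{PG}(2n,q)$ not in $H_\infty$ are called affine. The ABB-map $\phi$ sends $(a,b,1)_{\mathbb F_{q^n}}$ to the point $(a,b,1)_{\mathbb F_q}$ and $(a,b,0)_{\mathbb F_{q^n}}$ to the $(n-1)$-space $\{(ax,bx,0)_{\mathbb F_q}\mid x\in\mathbb F_{q^n}^*\}$. For $k\mid n$ let $$\mathcal D_k=\bigl\{\{(ax,bx,0)_{\mathbb F_q}\mid x\in\mathbb F_{q^k}^*\}\ \big|\ a,b\in\mathbb F_{q^n},\ (a,b)\ne(0,0)\bigr\}.$$ An $\mathbb F_{q^k}$-subline of $\mathrm{PG}(2,q^n)$,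 $k\mid n$, is a set $\{(su+tv)_{\mathbb F_{q^n}}\mid s,t\in\mathbb F_{q^k},\ (s,t)\neq(0,0)\}$ with $u,v\in\mathbb F_{q^n}^3$ linearly independent over $\mathbb F_{q^n}$; it is external to $l_\infty$ if it has no point on $l_\infty$, and tangent to $l_\infty$ if it has exactly one point on $l_\infty$. A normal rational curve of degree $d$, $2\le d\le q$, in $\mathrm{PG}(2n,q)$ is a set $\{(\sum_{i=0}^{d}s^{d-i}t^{i}e_i)_{\mathbb F_q}\mid s,t\in\mathbb F_q,\ (s,t)\ne(0,0)\}$ with $e_0,\dots,e_d$ linearly independent over $\mathbb F_q$. **Corollary 2.7.** Let $m$ be an $\mathbb F_{q^k}$-subline of $\mathrm{PG}(2,q^n)$ external to $l_\infty$, and suppose that the smallest subline (the one over the smallest field) that contains $m$ and is tangent to $l_\infty$ is an $\mathbb F_{q^r}$-subline. Then $M=\phi(m)$ is a set of $q^k+1$ affine points of $\mathrm{PG}(2n,q)$, no three collinear, and $M$ is contained in an $r$-dimensional projective subspace of $\mathrm{PG}(2n,q)$ that meets $H_\infty$ exactly in an element of $\mathcal D_r$. Moreover, any three distinct points of $M$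 determine an affine normal rational curve contained in $M$: there is exactly one $\mathbb F_q$-subline $m_0$ of $\mathrm{PG}(2,q^n)$ whose ABB-image $\phi(m_0)$ contains the three points, and $\phi(m_0)$ is a normal rational curve of some degree $d$ with $2\le d\le q$, all of whose points are affine and belong to $M$. -/

import Mathlib

/-!
Here `K` is the field with `q` elements and `L` its extension of degree `n`. The plane
PG(2, q^n) is `ℙ L (L × L × L)`, and PG(2n, q) is `ℙ K (L × L × K)`.
-/

open scoped LinearAlgebra.Projectivization

namespace ABB

/-- The line at infinity of PG(2, q^n): the points `(a, b, 0)`. -/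
def lineAtInfinity (L : Type*) [Field L] : Set (ℙ L (L × L × L)) :=
  {P | ∃ (a b : L) (h : ((a, b, 0) : L × L × L) ≠ 0), P = Projectivization.mk L (a, b, 0) h}

/-- The hyperplane at infinity of PG(2n, q): the points `(a, b, 0)`. -/
def hyperplaneAtInfinity (K L : Type*) [Field K] [Field L] [Algebra K L] :
    Set (ℙ K (L × L × K)) :=
  {Q | ∃ (a b : L) (h : ((a, b, 0) : L × L × K) ≠ 0), Q = Projectivization.mk K (a, b, 0) h}

/-- The subspread `D_k` of the hyperplane at infinity: the elements are the sets of points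
`{(a x, b x, 0) | x ∈ F, x ≠ 0}` with `(a, b) ≠ (0, 0)`, where `F` is the intermediate field
of degree `k` over `K`. -/
def subspread (K L : Type*) [Field K] [Field L] [Algebra K L] (k : ℕ) :
    Set (Set (ℙ K (L × L × K))) :=
  {E | ∃ F : IntermediateField K L, Module.finrank K F = k ∧
    ∃ a b : L, (a, b) ≠ (0, 0) ∧
      E = {Q | ∃ x ∈ F, ∃ h : ((a * x, b * x, 0) : L × L × K) ≠ 0,
        Q = Projectivization.mk K (a * x, b * x, 0) h}}

/-- The ABB-map. The image of an affine point `(a, b, 1)` is the point `(a, b, 1)` (as a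
singleton), the image of `(a, b, 0)` is the spread element `{(a x, b x, 0) | x ≠ 0}`. -/
def abbMap (K : Type*) {L : Type*} [Field K] [Field L] [Algebra K L]
    (P : ℙ L (L × L × L)) : Set (ℙ K (L × L × K)) :=
  {Q | (∃ (a b : L) (h : ((a, b, 1) : L × L × L) ≠ 0) (h' : ((a, b, 1) : L × L × K) ≠ 0),
      P = Projectivization.mk L (a, b, 1) h ∧ Q = Projectivization.mk K (a, b, 1) h') ∨
    (∃ (a b : L) (h : ((a, b, 0) : L × L × L) ≠ 0), P = Projectivization.mk L (a, b, 0) h ∧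
      ∃ (x : L) (h' : ((a * x, b * x, 0) : L × L × K) ≠ 0),
        Q = Projectivization.mk K (a * x, b * x, 0) h')}

/-- The ABB-image of a set of points of PG(2, q^n), as a set of points of PG(2n, q). -/
def abbImage (K : Type*) {L : Type*} [Field K] [Field L] [Algebra K L]
    (m : Set (ℙ L (L × L × L))) : Set (ℙ K (L × L × K)) :=
  ⋃ P ∈ m, abbMap K P

/-- `m` is an `𝔽_{q^k}`-subline of PG(2, q^n): for the intermediate field `F` of degree `k`
over `K` and two vectors `u`, `v` that are linearly independent over `L`, the set `m` consists
of the points `s u + t v` with `s, t ∈ F` not both zero. -/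
def IsSubline (K : Type*) {L : Type*} [Field K] [Field L] [Algebra K L] (k : ℕ)
    (m : Set (ℙ L (L × L × L))) : Prop :=
  ∃ F : IntermediateField K L, Module.finrank K F = k ∧
    ∃ u v : L × L × L, LinearIndependent L ![u, v] ∧
      m = {P | ∃ s ∈ F, ∃ t ∈ F, ∃ h : s • u + t • v ≠ 0,
        P = Projectivization.mk L (s • u + t • v) h}

/-- A set of points is external to the line at infinity if it is disjoint from it. -/
def IsExternal {L : Type*} [Field L] (m : Set (ℙ L (L × L × L))) : Prop :=
  Disjoint m (lineAtInfinity L)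

/-- A subline is tangent to the line at infinity if it has exactly one point on it. -/
def IsTangent {L : Type*} [Field L] (m : Set (ℙ L (L × L × L))) : Prop :=
  ∃! P, P ∈ m ∧ P ∈ lineAtInfinity L

/-- The smallest subline that contains `m` and is tangent to the line at infinity is an
`𝔽_{q^r}`-subline (smallest: over the smallest field). -/
def SmallestTangentDegree (K : Type*) {L : Type*} [Field K] [Field L] [Algebra K L]
    (m : Set (ℙ L (L × L × L))) (r : ℕ) : Prop :=
  (∃ m', IsSubline K r m' ∧ IsTangent m' ∧ m ⊆ m') ∧
    ∀ (s : ℕ) (m' : Set (ℙ L (L × L × L))),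
      IsSubline K s m' → IsTangent m' → m ⊆ m' → r ≤ s

/-- A normal rational curve of degree `d`, `2 ≤ d ≤ q`, in a projective space over `K`: the set
of points `∑ s ^ (d - i) t ^ i e_i`, `(s, t) ≠ (0, 0)`, for linearly independent
`e_0, …, e_d`. -/
def IsNormalRationalCurve {K V : Type*} [Field K] [AddCommGroup V] [Module K V] (d : ℕ)
    (C : Set (ℙ K V)) : Prop :=
  2 ≤ d ∧ d ≤ Nat.card K ∧ ∃ e : Fin (d + 1) → V, LinearIndependent K e ∧
    C = {Q | ∃ (s t : K) (h : ∑ i : Fin (d + 1), (s ^ (d - (i : ℕ)) * t ^ (i : ℕ)) • e i ≠ 0),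
      Q = Projectivization.mk K (∑ i : Fin (d + 1), (s ^ (d - (i : ℕ)) * t ^ (i : ℕ)) • e i) h}

end ABB

/-! Everything reduces to one linear form. For a subline `s u + t v` over `F`, being external means
that the third coordinate `s u₃ + t v₃` has no zero on `F² \ {0}`
(`IsExternal.combination_ne_zero`), so its ABB-image is obtained by dividing by that coordinate.
Counting then amounts to counting the projective line over `F`. Three points can be taken as `u`,
`v`, `u + v` (`exists_frame`); a `K`-relation between their affine vectors would give a zero of the
form over `K`, so they are not collinear (`not_isCollinear_frame`).

A tangent subline has a basis `p`, `w` with `p` at infinity and `w` affine. Its affine points are `w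
/ w₃ + z • (p / w₃)` with `z ∈ F`, which places them in a space of vector dimension `r + 1`
(`exists_subspace_of_basis_at_infinity`).

For the curve, put `x = -u₃ / v₃`, which lies outside `K`, and let `f` be its minimal polynomial.
The normalized point has denominator `t - x s`; multiplying by the homogenized value `N` of `f` at
`(s, t)`, which lies in `K`, leaves the quotient `g = f / (X - x)`. The coordinates become forms of
degree `d = deg f`, with `2 ≤ d ≤ n ≤ q`. Their coefficient vectors are independent because the
coefficients of `g` form a basis of `K(x)` (`isNormalRationalCurve_abbImage`). Uniqueness holds
because a frame determines the subline over a fixed field (`sublinePoints_eq_of_frame`). -/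

namespace ABB

open Projectivization

/-! ### The ABB-map on affine points -/

section Affine

variable {K L : Type*} [Field K] [Field L]

/-- The vector `(a / c, b / c, 1)` attached to `p = (a, b, c)`. -/
def affineVec (K : Type*) {L : Type*} [Field K] [Field L] (p : L × L × L) : L × L × K :=
  (p.1 / p.2.2, p.2.1 / p.2.2, 1)

lemma affineVec_ne_zero (p : L × L × L) : affineVec K p ≠ 0 := by
  intro h
  have := congrArg (fun x => x.2.2) h
  simp [affineVec] at this

lemma mk_eq_mk_of_affineVec_eq {p p' : L × L × L} (hp : p.2.2 ≠ 0) (hp' : p'.2.2 ≠ 0)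
    (h0 : p ≠ 0) (h0' : p' ≠ 0) (h : affineVec K p = affineVec K p') :
    Projectivization.mk L p h0 = Projectivization.mk L p' h0' := by
  rw [mk_eq_mk_iff']
  simp only [affineVec, Prod.mk.injEq] at h
  refine ⟨p.2.2 / p'.2.2, ?_⟩
  ext
  · simp only [Prod.smul_fst, smul_eq_mul]
    field_simp at h ⊢
    linear_combination -h.1
  · simp only [Prod.smul_snd, Prod.smul_fst, smul_eq_mul]
    field_simp at h ⊢
    linear_combination -h.2.1
  · simp only [Prod.smul_snd, smul_eq_mul]
    field_simp

lemma affineVec_smul (p : L × L × L) {c : L} (hc : c ≠ 0) :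
    affineVec K (c • p) = affineVec K p := by
  simp [affineVec, mul_div_mul_left _ _ hc]

/-- The ABB-image of the affine point spanned by `p`. -/
def affinePoint (K : Type*) {L : Type*} [Field K] [Field L] [Algebra K L]
    (p : L × L × L) : ℙ K (L × L × K) :=
  Projectivization.mk K (affineVec K p) (affineVec_ne_zero p)

variable [Algebra K L]

lemma mk_mem_lineAtInfinity_iff (p : L × L × L) (hp : p ≠ 0) :
    Projectivization.mk L p hp ∈ lineAtInfinity L ↔ p.2.2 = 0 := by
  constructor
  · rintro ⟨a, b, h, hP⟩
    obtain ⟨c, hc⟩ := (mk_eq_mk_iff' L _ _ _ _).1 hP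
    simp [← hc]
  · intro h
    obtain ⟨a, b, c⟩ := p
    obtain rfl : c = 0 := h
    exact ⟨a, b, hp, rfl⟩

lemma affinePoint_notMem_hyperplaneAtInfinity (p : L × L × L) :
    affinePoint K p ∉ hyperplaneAtInfinity K L := by
  rintro ⟨a, b, h, hP⟩
  obtain ⟨c, hc⟩ := (mk_eq_mk_iff' K _ _ _ _).1 hP
  have := congrArg (fun x => x.2.2) hc
  simp [affineVec] at this

/-- Both affine vectors end in 1, so proportionality over `K` is already equality. Hence the ABB-map
is injective on affine points. -/
lemma affinePoint_eq_iff {p p' : L × L × L} (hp : p.2.2 ≠ 0) (hp' : p'.2.2 ≠ 0)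
    (h0 : p ≠ 0) (h0' : p' ≠ 0) :
    affinePoint K p = affinePoint K p' ↔
      Projectivization.mk L p h0 = Projectivization.mk L p' h0' := by
  constructor
  · intro h
    obtain ⟨c, hc⟩ := (mk_eq_mk_iff' K _ _ _ _).1 h
    obtain rfl : c = 1 := by simpa [affineVec] using congrArg (fun x => x.2.2) hc
    rw [one_smul] at hc
    exact mk_eq_mk_of_affineVec_eq hp hp' h0 h0' hc.symm
  · intro h
    obtain ⟨c, rfl⟩ := (mk_eq_mk_iff' L _ _ _ _).1 h
    have hc : c ≠ 0 := by rintro rfl; simp at h0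
    simp only [affinePoint, affineVec_smul p' hc]

lemma affinePoint_mem_abbMap (p : L × L × L) (hp : p.2.2 ≠ 0) (h0 : p ≠ 0) :
    affinePoint K p ∈ abbMap K (Projectivization.mk L p h0) := by
  refine Or.inl ⟨p.1 / p.2.2, p.2.1 / p.2.2, by simp, affineVec_ne_zero p, ?_, rfl⟩
  rw [mk_eq_mk_iff']
  refine ⟨p.2.2, ?_⟩
  ext <;> simp [mul_div_cancel₀ _ hp]

lemma eq_mk_of_affinePoint_mem_abbMap {p : L × L × L} (hp : p.2.2 ≠ 0) (h0 : p ≠ 0)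
    {P : ℙ L (L × L × L)} (h : affinePoint K p ∈ abbMap K P) :
    P = Projectivization.mk L p h0 := by
  rcases h with ⟨a, b, h, h', rfl, hQ⟩ | ⟨a, b, h, rfl, x, h', hQ⟩
  · have : affinePoint K p = affinePoint K (a, b, (1 : L)) := by
      rw [hQ]; simp [affinePoint, affineVec]
    exact ((affinePoint_eq_iff hp (by simp) h0 h).1 this).symm
  · exact absurd ⟨_, _, _, hQ⟩ (affinePoint_notMem_hyperplaneAtInfinity (K := K) p)

lemma mem_abbMap_mk_iff (p : L × L × L) (hp : p.2.2 ≠ 0) (h0 : p ≠ 0) (Q : ℙ K (L × L × K)) :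
    Q ∈ abbMap K (Projectivization.mk L p h0) ↔ Q = affinePoint K p := by
  constructor
  · rintro (⟨a, b, h, h', hP, rfl⟩ | ⟨a, b, h, hP, -⟩)
    · have := (affinePoint_eq_iff (K := K) hp (p' := (a, b, 1)) (by simp) h0 h).2 hP
      rw [this]; simp [affinePoint, affineVec]
    · exact absurd ((mk_mem_lineAtInfinity_iff p h0).1 ⟨_, _, _, hP⟩) hp
  · rintro rfl
    exact affinePoint_mem_abbMap p hp h0

end Affine

/-! ### Sublines, frames and external sublines -/

section Subline

variable {K L : Type*} [Field K] [Field L] [Algebra K L]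

/-- The points `s u + t v` with `s`, `t` in the intermediate field `F`, not both zero. -/
def sublinePoints (F : IntermediateField K L) (u v : L × L × L) : Set (ℙ L (L × L × L)) :=
  {P | ∃ s ∈ F, ∃ t ∈ F, ∃ h : s • u + t • v ≠ 0, P = Projectivization.mk L (s • u + t • v) h}

variable {F : IntermediateField K L} {u v : L × L × L}

lemma ne_zero_of_combination_ne_zero {s t : L} (h : s • u + t • v ≠ 0) : ¬ (s = 0 ∧ t = 0) := by
  rintro ⟨rfl, rfl⟩; simp at h

lemma combination_ne_zero (huv : LinearIndependent L ![u, v]) {s t : L} (h : ¬ (s = 0 ∧ t = 0)) :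
    s • u + t • v ≠ 0 := fun h0 => h (LinearIndependent.pair_iff.1 huv s t h0)

lemma mk_combination_eq_of_det_eq_zero {s t s' t' : L} (h : s • u + t • v ≠ 0)
    (h' : s' • u + t' • v ≠ 0) (hd : s * t' - s' * t = 0) :
    Projectivization.mk L _ h = Projectivization.mk L _ h' := by
  rw [mk_eq_mk_iff']
  by_cases hs : s' = 0
  · have ht : t' ≠ 0 := fun ht => ne_zero_of_combination_ne_zero h' ⟨hs, ht⟩
    obtain rfl : s = 0 := by simpa [hs, ht] using hd
    exact ⟨t / t', by simp [hs, smul_smul, ht]⟩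
  · refine ⟨s / s', ?_⟩
    have : s / s' * t' = t := by field_simp; linear_combination hd
    rw [smul_add, smul_smul, smul_smul, this, div_mul_cancel₀ _ hs]

lemma linearIndependent_combination (huv : LinearIndependent L ![u, v]) {a b c d : L}
    (hd : a * d - c * b ≠ 0) : LinearIndependent L ![a • u + b • v, c • u + d • v] := by
  rw [LinearIndependent.pair_iff] at huv ⊢
  intro s t hst
  obtain ⟨h1, h2⟩ := huv (s * a + t * c) (s * b + t * d) (by rw [← hst]; module)
  constructor
  · apply (mul_eq_zero.1 (_ : (a * d - c * b) * s = 0)).resolve_left hd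
    linear_combination d * h1 - c * h2
  · apply (mul_eq_zero.1 (_ : (a * d - c * b) * t = 0)).resolve_left hd
    linear_combination a * h2 - b * h1

lemma sublinePoints_combination_subset {a b c d : L} (ha : a ∈ F) (hb : b ∈ F) (hc : c ∈ F)
    (hd : d ∈ F) :
    sublinePoints F (a • u + b • v) (c • u + d • v) ⊆ sublinePoints F u v := by
  rintro P ⟨s, hs, t, ht, h, rfl⟩
  have key : s • (a • u + b • v) + t • (c • u + d • v) =
      (s * a + t * c) • u + (s * b + t * d) • v := by module
  refine ⟨s * a + t * c, add_mem (mul_mem hs ha) (mul_mem ht hc),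
    s * b + t * d, add_mem (mul_mem hs hb) (mul_mem ht hd), key ▸ h, ?_⟩
  simp only [key]

lemma sublinePoints_combination {a b c d : L} (ha : a ∈ F) (hb : b ∈ F) (hc : c ∈ F)
    (hd : d ∈ F) (hD : a * d - c * b ≠ 0) :
    sublinePoints F (a • u + b • v) (c • u + d • v) = sublinePoints F u v := by
  refine (sublinePoints_combination_subset ha hb hc hd).antisymm ?_
  obtain ⟨e, he⟩ : ∃ e, e = (a * d - c * b)⁻¹ := ⟨_, rfl⟩
  have heF : e ∈ F := he ▸ inv_mem (sub_mem (mul_mem ha hd) (mul_mem hc hb))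
  have he1 : e * (a * d - c * b) = 1 := he ▸ inv_mul_cancel₀ hD
  -- Inverse of the 2 × 2 change of basis; its entries stay in `F` because `e`, the inverse
  -- determinant, does.
  have hu : u = (e * d) • (a • u + b • v) + (-(e * b)) • (c • u + d • v) := by
    match_scalars
    · linear_combination -he1
    · ring
  have hv : v = (-(e * c)) • (a • u + b • v) + (e * a) • (c • u + d • v) := by
    match_scalars
    · linear_combination -he1
    · ring
  have := sublinePoints_combination_subset (F := F) (u := a • u + b • v) (v := c • u + d • v)
    (mul_mem heF hd) (neg_mem (mul_mem heF hb)) (neg_mem (mul_mem heF hc)) (mul_mem heF ha)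
  rwa [← hu, ← hv] at this

/-- Three distinct points of a subline are the points `u`, `v`, `u + v` for a suitable basis. -/
lemma exists_frame (huv : LinearIndependent L ![u, v]) {P₁ P₂ P₃ : ℙ L (L × L × L)}
    (h₁ : P₁ ∈ sublinePoints F u v) (h₂ : P₂ ∈ sublinePoints F u v)
    (h₃ : P₃ ∈ sublinePoints F u v) (h₁₂ : P₁ ≠ P₂) (h₁₃ : P₁ ≠ P₃) (h₂₃ : P₂ ≠ P₃) :
    ∃ u' v' : L × L × L, ∃ (hu : u' ≠ 0) (hv : v' ≠ 0) (huv' : u' + v' ≠ 0),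
      LinearIndependent L ![u', v'] ∧ sublinePoints F u' v' = sublinePoints F u v ∧
      P₁ = Projectivization.mk L u' hu ∧ P₂ = Projectivization.mk L v' hv ∧
      P₃ = Projectivization.mk L (u' + v') huv' := by
  obtain ⟨s₁, hs₁, t₁, ht₁, n₁, rfl⟩ := h₁
  obtain ⟨s₂, hs₂, t₂, ht₂, n₂, rfl⟩ := h₂
  obtain ⟨s₃, hs₃, t₃, ht₃, n₃, rfl⟩ := h₃
  have d₁₂ : s₁ * t₂ - s₂ * t₁ ≠ 0 := mt (mk_combination_eq_of_det_eq_zero n₁ n₂) h₁₂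
  have d₁₃ : s₁ * t₃ - s₃ * t₁ ≠ 0 := mt (mk_combination_eq_of_det_eq_zero n₁ n₃) h₁₃
  have d₂₃ : s₂ * t₃ - s₃ * t₂ ≠ 0 := mt (mk_combination_eq_of_det_eq_zero n₂ n₃) h₂₃
  have hDF : s₁ * t₂ - s₂ * t₁ ∈ F := sub_mem (mul_mem hs₁ ht₂) (mul_mem hs₂ ht₁)
  -- Cramer's rule for writing the third point's vector as `x` times the first plus `y` times the
  -- second. Pairwise distinctness makes both coefficients nonzero, so they can be absorbed into the
  -- basis.
  obtain ⟨x, hx⟩ : ∃ x, x = -(s₂ * t₃ - s₃ * t₂) / (s₁ * t₂ - s₂ * t₁) := ⟨_, rfl⟩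
  obtain ⟨y, hy⟩ : ∃ y, y = (s₁ * t₃ - s₃ * t₁) / (s₁ * t₂ - s₂ * t₁) := ⟨_, rfl⟩
  have hxF : x ∈ F := hx ▸ div_mem (neg_mem (sub_mem (mul_mem hs₂ ht₃) (mul_mem hs₃ ht₂))) hDF
  have hyF : y ∈ F := hy ▸ div_mem (sub_mem (mul_mem hs₁ ht₃) (mul_mem hs₃ ht₁)) hDF
  have hx0 : x ≠ 0 := hx ▸ div_ne_zero (neg_ne_zero.2 d₂₃) d₁₂
  have hy0 : y ≠ 0 := hy ▸ div_ne_zero d₁₃ d₁₂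
  have eu : (x * s₁) • u + (x * t₁) • v = x • (s₁ • u + t₁ • v) := by module
  have ev : (y * s₂) • u + (y * t₂) • v = y • (s₂ • u + t₂ • v) := by module
  have hD : x * s₁ * (y * t₂) - y * s₂ * (x * t₁) ≠ 0 := by
    rw [show x * s₁ * (y * t₂) - y * s₂ * (x * t₁) = x * y * (s₁ * t₂ - s₂ * t₁) by ring]
    exact mul_ne_zero (mul_ne_zero hx0 hy0) d₁₂
  have hxD : x * (s₁ * t₂ - s₂ * t₁) = -(s₂ * t₃ - s₃ * t₂) := by rw [hx, div_mul_cancel₀ _ d₁₂]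
  have hyD : y * (s₁ * t₂ - s₂ * t₁) = s₁ * t₃ - s₃ * t₁ := by rw [hy, div_mul_cancel₀ _ d₁₂]
  have es : s₃ = x * s₁ + y * s₂ := by
    apply mul_right_cancel₀ d₁₂
    linear_combination -s₁ * hxD - s₂ * hyD
  have et : t₃ = x * t₁ + y * t₂ := by
    apply mul_right_cancel₀ d₁₂
    linear_combination -t₁ * hxD - t₂ * hyD
  have e₃ : s₃ • u + t₃ • v =
      ((x * s₁) • u + (x * t₁) • v) + ((y * s₂) • u + (y * t₂) • v) := by
    rw [es, et]; module
  refine ⟨(x * s₁) • u + (x * t₁) • v, (y * s₂) • u + (y * t₂) • v,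
    eu ▸ smul_ne_zero hx0 n₁, ev ▸ smul_ne_zero hy0 n₂, e₃ ▸ n₃,
    linearIndependent_combination huv hD,
    sublinePoints_combination (mul_mem hxF hs₁) (mul_mem hxF ht₁) (mul_mem hyF hs₂)
      (mul_mem hyF ht₂) hD, ?_, ?_, ?_⟩
  · rw [eq_comm, mk_eq_mk_iff']
    exact ⟨x, eu.symm⟩
  · rw [eq_comm, mk_eq_mk_iff']
    exact ⟨y, ev.symm⟩
  · simp only [e₃]

/-- A subline with a point at infinity and an affine point has a basis consisting of a vector
at infinity and an affine vector. -/
lemma exists_basis_at_infinity (huv : LinearIndependent L ![u, v]) {P Q : ℙ L (L × L × L)}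
    (hP : P ∈ sublinePoints F u v) (hP' : P ∈ lineAtInfinity L)
    (hQ : Q ∈ sublinePoints F u v) (hQ' : Q ∉ lineAtInfinity L) :
    ∃ p w : L × L × L, LinearIndependent L ![p, w] ∧
      sublinePoints F p w = sublinePoints F u v ∧ p.2.2 = 0 ∧ w.2.2 ≠ 0 := by
  have hne : P ≠ Q := fun h => hQ' (h ▸ hP')
  obtain ⟨s₁, hs₁, t₁, ht₁, n₁, rfl⟩ := hP
  obtain ⟨s₂, hs₂, t₂, ht₂, n₂, rfl⟩ := hQ
  have hD : s₁ * t₂ - s₂ * t₁ ≠ 0 := mt (mk_combination_eq_of_det_eq_zero n₁ n₂) hne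
  exact ⟨_, _, linearIndependent_combination huv hD,
    sublinePoints_combination hs₁ ht₁ hs₂ ht₂ hD,
    (mk_mem_lineAtInfinity_iff _ n₁).1 hP', mt (mk_mem_lineAtInfinity_iff _ n₂).2 hQ'⟩

lemma IsExternal.combination_ne_zero (huv : LinearIndependent L ![u, v])
    (hext : IsExternal (sublinePoints F u v)) {s t : L} (hs : s ∈ F) (ht : t ∈ F)
    (h : ¬ (s = 0 ∧ t = 0)) : (s • u + t • v).2.2 ≠ 0 := by
  have h0 := ABB.combination_ne_zero huv h
  intro h3
  exact Set.disjoint_left.1 hext ⟨s, hs, t, ht, h0, rfl⟩ ((mk_mem_lineAtInfinity_iff _ h0).2 h3)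

lemma mem_abbImage_sublinePoints_iff (huv : LinearIndependent L ![u, v])
    (hext : IsExternal (sublinePoints F u v)) (X : ℙ K (L × L × K)) :
    X ∈ abbImage K (sublinePoints F u v) ↔
      ∃ s ∈ F, ∃ t ∈ F, ¬ (s = 0 ∧ t = 0) ∧ X = affinePoint K (s • u + t • v) := by
  simp only [abbImage, Set.mem_iUnion, exists_prop]
  constructor
  · rintro ⟨P, ⟨s, hs, t, ht, h, rfl⟩, hX⟩
    have hst := ne_zero_of_combination_ne_zero h
    exact ⟨s, hs, t, ht, hst,
      (mem_abbMap_mk_iff _ (hext.combination_ne_zero huv hs ht hst) h X).1 hX⟩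
  · rintro ⟨s, hs, t, ht, hst, rfl⟩
    have h := combination_ne_zero huv hst
    exact ⟨_, ⟨s, hs, t, ht, h, rfl⟩,
      affinePoint_mem_abbMap _ (hext.combination_ne_zero huv hs ht hst) h⟩

lemma disjoint_abbImage_hyperplaneAtInfinity (huv : LinearIndependent L ![u, v])
    (hext : IsExternal (sublinePoints F u v)) :
    Disjoint (abbImage K (sublinePoints F u v)) (hyperplaneAtInfinity K L) := by
  rw [Set.disjoint_left]
  intro X hX
  obtain ⟨s, -, t, -, -, rfl⟩ := (mem_abbImage_sublinePoints_iff huv hext X).1 hX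
  exact affinePoint_notMem_hyperplaneAtInfinity _

lemma ncard_abbImage_sublinePoints [Finite F] (huv : LinearIndependent L ![u, v])
    (hext : IsExternal (sublinePoints F u v)) :
    (abbImage K (sublinePoints F u v)).ncard = Nat.card F + 1 := by
  -- The projective line over `F`: `none` is `(1, 0)` and `some x` is `(x, 1)`.
  let c : Option F → L × L := fun o => o.elim (1, 0) fun x => ((x : L), 1)
  have hcF : ∀ o, (c o).1 ∈ F ∧ (c o).2 ∈ F := by
    rintro (_ | x)
    · exact ⟨one_mem F, zero_mem F⟩
    · exact ⟨x.2, one_mem F⟩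
  have hc0 : ∀ o, ¬ ((c o).1 = 0 ∧ (c o).2 = 0) := by rintro (_ | x) <;> simp [c]
  let f : Option F → ℙ K (L × L × K) := fun o => affinePoint K ((c o).1 • u + (c o).2 • v)
  have hf : Function.Injective f := by
    intro o o' h
    obtain ⟨a, ha⟩ := (mk_eq_mk_iff' L _ _ _ _).1 ((affinePoint_eq_iff
      (hext.combination_ne_zero huv (hcF o).1 (hcF o).2 (hc0 o))
      (hext.combination_ne_zero huv (hcF o').1 (hcF o').2 (hc0 o'))
      (combination_ne_zero huv (hc0 o)) (combination_ne_zero huv (hc0 o'))).1 h)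
    obtain ⟨h1, h2⟩ := LinearIndependent.pair_iff.1 huv (a * (c o').1 - (c o).1)
      (a * (c o').2 - (c o).2) (by rw [← sub_eq_zero.2 ha]; module)
    rcases o with _ | x <;> rcases o' with _ | x'
    · rfl
    · simp only [c, Option.elim] at h1 h2
      simp_all
    · simp [c] at h2
    · simp only [c, Option.elim] at h1 h2
      have ha1 : a = 1 := by linear_combination h2
      rw [ha1] at h1
      rw [Option.some_inj]
      exact Subtype.ext (by linear_combination -h1)
  have hrange : abbImage K (sublinePoints F u v) = Set.range f := by
    ext X
    rw [mem_abbImage_sublinePoints_iff huv hext]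
    constructor
    · rintro ⟨s, hs, t, ht, hst, rfl⟩
      by_cases h0 : t = 0
      · have hs0 : s ≠ 0 := fun h => hst ⟨h, h0⟩
        refine ⟨none, ?_⟩
        have : s • u + t • v = s • ((1 : L) • u + (0 : L) • v) := by rw [h0]; module
        simp only [f, c, Option.elim, affinePoint, this, affineVec_smul _ hs0]
      · refine ⟨some ⟨s / t, div_mem hs ht⟩, ?_⟩
        have : s • u + t • v = t • ((s / t) • u + (1 : L) • v) := by
          rw [smul_add, smul_smul, mul_div_cancel₀ _ h0, one_smul]
        simp only [f, c, Option.elim, affinePoint, this, affineVec_smul _ h0]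
    · rintro ⟨o, rfl⟩
      exact ⟨_, (hcF o).1, _, (hcF o).2, hc0 o, rfl⟩
  rw [hrange, ← Nat.card_coe_set_eq, Nat.card_range_of_injective hf, Finite.card_option]

/-- The points of the ABB-image of an external subline spanned by a frame are not collinear. -/
lemma not_isCollinear_frame (huv : LinearIndependent L ![u, v])
    (hext : IsExternal (sublinePoints F u v)) :
    ¬ Projectivization.IsCollinear
      ({affinePoint K u, affinePoint K v, affinePoint K (u + v)} : Set (ℙ K (L × L × K))) := by
  have hu : u.2.2 ≠ 0 := by
    simpa using hext.combination_ne_zero huv (one_mem F) (zero_mem F) (by simp)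
  have hv : v.2.2 ≠ 0 := by
    simpa using hext.combination_ne_zero huv (zero_mem F) (one_mem F) (by simp)
  have hw : u.2.2 + v.2.2 ≠ 0 := by
    simpa using hext.combination_ne_zero huv (one_mem F) (one_mem F) (by simp)
  rintro ⟨S, hfin, hrank, hS⟩
  have mem : ∀ p, affinePoint K p ∈ S → affineVec K p ∈ Subspace.submodule S := fun p hp =>
    (Subspace.mem_submodule_iff S (affineVec_ne_zero p)).2 hp
  let e : Fin 3 → Subspace.submodule S := ![⟨_, mem u (hS (by simp))⟩,
    ⟨_, mem v (hS (by simp))⟩, ⟨_, mem (u + v) (hS (by simp))⟩]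
  have hli : LinearIndependent K e := by
    rw [Fintype.linearIndependent_iff]
    intro c hc
    have hc' : c 0 • affineVec K u + c 1 • affineVec K v + c 2 • affineVec K (u + v) = 0 := by
      simpa [e, Fin.sum_univ_three] using congrArg Subtype.val hc
    -- Clearing the normalizations turns the `K`-relation into `x • u + y • v = 0`, so `x` and `y`
    -- vanish by independence over `L`.
    obtain ⟨x, hx⟩ : ∃ x, x = algebraMap K L (c 0) / u.2.2 +
      algebraMap K L (c 2) / (u.2.2 + v.2.2) := ⟨_, rfl⟩
    obtain ⟨y, hy⟩ : ∃ y, y = algebraMap K L (c 1) / v.2.2 +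
      algebraMap K L (c 2) / (u.2.2 + v.2.2) := ⟨_, rfl⟩
    have h1 := congrArg (fun p => p.1) hc'
    have h2 := congrArg (fun p => p.2.1) hc'
    have h3 := congrArg (fun p => algebraMap K L p.2.2) hc'
    simp only [affineVec, Prod.fst_add, Prod.snd_add, Prod.smul_fst, Prod.smul_snd,
      Prod.fst_zero, Prod.snd_zero, map_add, map_zero, smul_eq_mul, mul_one] at h1 h2 h3
    rw [Algebra.smul_def, Algebra.smul_def, Algebra.smul_def] at h1 h2
    obtain ⟨hx0, hy0⟩ := LinearIndependent.pair_iff.1 huv x y (by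
      ext
      · simp only [Prod.fst_add, Prod.smul_fst, smul_eq_mul, Prod.fst_zero]
        rw [← h1, hx, hy]; ring
      · simp only [Prod.fst_add, Prod.snd_add, Prod.smul_snd, Prod.smul_fst, smul_eq_mul,
          Prod.fst_zero, Prod.snd_zero]
        rw [← h2, hx, hy]; ring
      · simp only [Prod.snd_add, Prod.smul_snd, smul_eq_mul, Prod.snd_zero]
        rw [← h3, hx, hy]; field_simp; ring)
    rw [hx] at hx0
    rw [hy] at hy0
    -- Eliminating `c 2` shows that `-c 1 • u + c 0 • v` lies at infinity. As `K ⊆ F`, externality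
    -- forces both coefficients to be zero.
    have hrel : (algebraMap K L (-c 1)) * u.2.2 + algebraMap K L (c 0) * v.2.2 = 0 := by
      have : algebraMap K L (c 0) / u.2.2 = algebraMap K L (c 1) / v.2.2 := by
        linear_combination hx0 - hy0
      rw [div_eq_div_iff hu hv] at this
      rw [map_neg]
      linear_combination this
    have hzero : c 1 = 0 ∧ c 0 = 0 := by
      by_contra hne
      exact hext.combination_ne_zero huv (F.algebraMap_mem (-c 1)) (F.algebraMap_mem (c 0))
        (by simpa using hne) hrel
    have hc2 : c 2 = 0 := by simpa [hzero, hw] using hx0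
    intro i
    fin_cases i
    exacts [hzero.2, hzero.1, hc2]
  have := hli.fintype_card_le_finrank
  simp at this
  omega

/-- A subline over a given field is determined by a frame. -/
lemma sublinePoints_eq_of_frame {u' v' : L × L × L} (huv : LinearIndependent L ![u, v])
    (hu : u ≠ 0) (hv : v ≠ 0) (hw : u + v ≠ 0) (hu' : u' ≠ 0) (hv' : v' ≠ 0)
    (hw' : u' + v' ≠ 0)
    (h₁ : Projectivization.mk L u' hu' = Projectivization.mk L u hu)
    (h₂ : Projectivization.mk L v' hv' = Projectivization.mk L v hv)
    (h₃ : Projectivization.mk L (u' + v') hw' = Projectivization.mk L (u + v) hw) :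
    sublinePoints F u' v' = sublinePoints F u v := by
  obtain ⟨a, rfl⟩ := (mk_eq_mk_iff' L _ _ _ _).1 h₁
  obtain ⟨b, rfl⟩ := (mk_eq_mk_iff' L _ _ _ _).1 h₂
  obtain ⟨c, hc⟩ := (mk_eq_mk_iff' L _ _ _ _).1 h₃
  obtain ⟨hca, hcb⟩ := LinearIndependent.pair_iff.1 huv (c - a) (c - b) (by
    rw [← sub_eq_zero.2 hc]; module)
  obtain rfl := sub_eq_zero.1 hca
  obtain rfl := sub_eq_zero.1 hcb
  have hc0 : c ≠ 0 := by rintro rfl; simp at hu'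
  have key : ∀ s t : L, s • c • u + t • c • v = c • (s • u + t • v) := fun s t => by module
  ext P
  constructor
  · rintro ⟨s, hs, t, ht, h, rfl⟩
    rw [key, smul_ne_zero_iff] at h
    refine ⟨s, hs, t, ht, h.2, ?_⟩
    rw [mk_eq_mk_iff']
    exact ⟨c, (key s t).symm⟩
  · rintro ⟨s, hs, t, ht, h, rfl⟩
    refine ⟨s, hs, t, ht, key s t ▸ smul_ne_zero hc0 h, ?_⟩
    rw [eq_comm, mk_eq_mk_iff']
    exact ⟨c, (key s t).symm⟩

end Subline

end ABB

namespace ABB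

open Projectivization

/-! ### Normal rational curves from minimal polynomials -/

section RationalCurve

open Polynomial

variable {K L : Type*} [Field K] [Field L] [Algebra K L]

/-- The bound `d` may exceed the degree: below, `g` has degree less than `d` but is homogenized in
degree `d`, together with `f`. -/
lemma sum_homogenize {E : Type*} [Field E] (f : E[X]) {d : ℕ} (hd : f.natDegree ≤ d) {s : E}
    (hs : s ≠ 0) (t : E) :
    ∑ i : Fin (d + 1), s ^ (d - (i : ℕ)) * t ^ (i : ℕ) * f.coeff i = s ^ d * f.eval (t / s) := by
  rw [eval_eq_sum_range' (Nat.lt_succ_of_le hd), Finset.mul_sum,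
    Fin.sum_univ_eq_sum_range (fun i => s ^ (d - i) * t ^ i * f.coeff i)]
  refine Finset.sum_congr rfl fun i hi => ?_
  have hi' : i ≤ d := Nat.lt_succ_iff.1 (Finset.mem_range.1 hi)
  rw [div_pow, ← Nat.sub_add_cancel hi', pow_add, Nat.add_sub_cancel]
  field_simp

lemma sum_homogenize_zero {E : Type*} [Field E] (f : E[X]) (d : ℕ) (t : E) :
    ∑ i : Fin (d + 1), (0 : E) ^ (d - (i : ℕ)) * t ^ (i : ℕ) * f.coeff i = t ^ d * f.coeff d := by
  rw [Fin.sum_univ_castSucc, Finset.sum_eq_zero]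
  · simp
  · intro i _
    have : d - (i : ℕ) ≠ 0 := by omega
    simp [this]

/-- The coefficients of `minpolyDiv` below the degree of the minimal polynomial are linearly
independent. -/
lemma linearIndependent_coeff_minpolyDiv {x : L} (hx : IsIntegral K x) :
    LinearIndependent K
      (fun i : Fin (minpoly K x).natDegree => (minpolyDiv K x).coeff i) := by
  rw [linearIndependent_iff_card_eq_finrank_span, Fintype.card_fin]
  have hspan : Submodule.span K
      (Set.range fun i : Fin (minpoly K x).natDegree => (minpolyDiv K x).coeff i) =
      Subalgebra.toSubmodule (Algebra.adjoin K {x}) := by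
    -- All coefficients together span `K[x]`, and those beyond the listed range vanish. The listed
    -- ones are thus a spanning family whose size is the dimension.
    rw [← span_coeff_minpolyDiv hx]
    apply le_antisymm
    · apply Submodule.span_mono
      rintro _ ⟨i, rfl⟩
      exact ⟨i, rfl⟩
    · rw [Submodule.span_le]
      rintro _ ⟨i, rfl⟩
      by_cases hi : i < (minpoly K x).natDegree
      · exact Submodule.subset_span ⟨⟨i, hi⟩, rfl⟩
      · rw [coeff_eq_zero_of_natDegree_lt
          ((natDegree_minpolyDiv_lt hx).trans_le (not_lt.1 hi))]
        exact zero_mem _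
  rw [Set.finrank, hspan, Subalgebra.finrank_toSubmodule,
    ← IntermediateField.adjoin_simple_toSubalgebra_of_isAlgebraic hx.isAlgebraic,
    ← IntermediateField.adjoin.finrank hx]
  rfl

/-- The ABB-image of an external subline over the ground field is a normal rational curve. -/
lemma isNormalRationalCurve_abbImage [FiniteDimensional K L]
    (hcard : Module.finrank K L ≤ Nat.card K) {u v : L × L × L}
    (huv : LinearIndependent L ![u, v])
    (hext : IsExternal (sublinePoints (⊥ : IntermediateField K L) u v)) :
    ∃ d, IsNormalRationalCurve d (abbImage K (sublinePoints (⊥ : IntermediateField K L) u v)) := by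
  obtain ⟨β, hβ⟩ : ∃ β, β = v.2.2 := ⟨_, rfl⟩
  have hβ0 : β ≠ 0 := by
    have := hext.combination_ne_zero huv (zero_mem _) (one_mem _) (by simp)
    simpa [hβ] using this
  obtain ⟨x, hx⟩ : ∃ x, x = -u.2.2 / β := ⟨_, rfl⟩
  have hu3 : u.2.2 = -x * β := by rw [hx]; field_simp
  have hxint : IsIntegral K x := Algebra.IsIntegral.isIntegral x
  have hxK : x ∉ (algebraMap K L).range := by
    rintro ⟨y, hy⟩
    refine hext.combination_ne_zero huv (one_mem _)
      (IntermediateField.algebraMap_mem _ y) (by simp) ?_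
    simp only [Prod.snd_add, Prod.smul_snd, smul_eq_mul, hy, hu3, ← hβ]
    ring
  obtain ⟨f, hf⟩ : ∃ f, f = minpoly K x := ⟨_, rfl⟩
  obtain ⟨g, hg⟩ : ∃ g, g = minpolyDiv K x := ⟨_, rfl⟩
  obtain ⟨d, hd⟩ : ∃ d, d = f.natDegree := ⟨_, rfl⟩
  have hgd : g.natDegree < d := by rw [hd, hf, hg]; exact natDegree_minpolyDiv_lt hxint
  have hgcd : g.coeff d = 0 := coeff_eq_zero_of_natDegree_lt hgd
  have hfd : f.coeff d = 1 := by rw [hd, hf]; exact minpoly.monic hxint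
  have hgf : g * (X - C x) = f.map (algebraMap K L) := by
    rw [hg, hf]; exact minpolyDiv_spec K x
  -- The point at infinity of the `L`-line through `u` and `v`. From `s u + t v = s (u + x v) + (t -
  -- x s) v`, the normalized point is `v / β + (s / (t - x s)) w`.
  obtain ⟨w, hw⟩ : ∃ w : L × L × L, w = β⁻¹ • (u + x • v) := ⟨_, rfl⟩
  have hw0 : w.1 ≠ 0 ∨ w.2.1 ≠ 0 := by
    have hw3 : w.2.2 = 0 := by
      rw [hw]
      simp only [Prod.smul_snd, Prod.snd_add, smul_eq_mul, hu3, ← hβ]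
      ring
    have : w ≠ 0 := by
      rw [hw, smul_ne_zero_iff]
      refine ⟨inv_ne_zero hβ0, ?_⟩
      simpa using combination_ne_zero huv (s := 1) (t := x) (by simp)
    contrapose! this
    exact Prod.ext this.1 (Prod.ext this.2 hw3)
  -- Coefficient vectors of `N • (v / β) + H • w`, where `N` and `H` are the degree `d`
  -- homogenizations of `f` and `g`.
  let e : Fin (d + 1) → L × L × K := fun i =>
    (v.1 / β * algebraMap K L (f.coeff i) + w.1 * g.coeff i,
      v.2.1 / β * algebraMap K L (f.coeff i) + w.2.1 * g.coeff i, f.coeff i)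
  have he : ∀ c : Fin (d + 1) → K, ∑ i, c i • e i =
      (v.1 / β * algebraMap K L (∑ i, c i * f.coeff i) +
          w.1 * ∑ i, algebraMap K L (c i) * g.coeff i,
        v.2.1 / β * algebraMap K L (∑ i, c i * f.coeff i) +
          w.2.1 * ∑ i, algebraMap K L (c i) * g.coeff i,
        ∑ i, c i * f.coeff i) := by
    intro c
    ext
    · simp only [e, Prod.fst_sum, Prod.smul_fst, map_sum, map_mul, Finset.mul_sum,
        ← Finset.sum_add_distrib]
      exact Finset.sum_congr rfl fun i _ => by rw [Algebra.smul_def]; ring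
    · simp only [e, Prod.fst_sum, Prod.snd_sum, Prod.smul_snd, Prod.smul_fst, map_sum, map_mul,
        Finset.mul_sum, ← Finset.sum_add_distrib]
      exact Finset.sum_congr rfl fun i _ => by rw [Algebra.smul_def]; ring
    · simp only [e, Prod.snd_sum, Prod.smul_snd, smul_eq_mul]
  have hli : LinearIndependent K e := by
    rw [Fintype.linearIndependent_iff]
    intro c hc
    rw [he c] at hc
    simp only [Prod.mk_eq_zero] at hc
    obtain ⟨h1, h2, h3⟩ := hc
    rw [h3, map_zero, mul_zero, zero_add] at h1 h2
    have h4 : ∑ i, algebraMap K L (c i) * g.coeff i = 0 := by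
      rcases hw0 with h | h
      · exact (mul_eq_zero.1 h1).resolve_left h
      · exact (mul_eq_zero.1 h2).resolve_left h
    -- Since `g.coeff d = 0`, this relation only sees the indices below `d`. The last coefficient is
    -- then killed by the monicity of `f`.
    rw [Fin.sum_univ_castSucc] at h4
    simp only [Fin.val_castSucc, Fin.val_last, hgcd, mul_zero, add_zero,
      ← Algebra.smul_def] at h4
    have hgli : LinearIndependent K (fun i : Fin d => g.coeff i) := by
      rw [hd, hf, hg]; exact linearIndependent_coeff_minpolyDiv hxint
    have h5 := Fintype.linearIndependent_iff.1 hgli (fun i => c i.castSucc) h4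
    rw [Fin.sum_univ_castSucc] at h3
    simp only [h5, zero_mul, Finset.sum_const_zero, zero_add, Fin.val_last, hfd, mul_one] at h3
    intro i
    induction i using Fin.lastCases with
    | last => exact h3
    | cast i => exact h5 i
  have key : ∀ s t : K, ¬ (s = 0 ∧ t = 0) → ∃ N : K, N ≠ 0 ∧
      ∑ i : Fin (d + 1), (s ^ (d - (i : ℕ)) * t ^ (i : ℕ)) • e i =
        N • affineVec K (algebraMap K L s • u + algebraMap K L t • v) := by
    intro s t hst
    have hden : algebraMap K L t - x * algebraMap K L s ≠ 0 := by
      have := hext.combination_ne_zero huv (IntermediateField.algebraMap_mem _ s)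
        (IntermediateField.algebraMap_mem _ t) (by simpa using hst)
      intro h
      apply this
      simp only [Prod.snd_add, Prod.smul_snd, smul_eq_mul, hu3, ← hβ]
      linear_combination β * h
    obtain ⟨N, hN⟩ : ∃ N, N = ∑ i : Fin (d + 1), s ^ (d - (i : ℕ)) * t ^ (i : ℕ) * f.coeff i :=
      ⟨_, rfl⟩
    obtain ⟨H, hH⟩ : ∃ H, H = ∑ i : Fin (d + 1),
      algebraMap K L (s ^ (d - (i : ℕ)) * t ^ (i : ℕ)) * g.coeff i := ⟨_, rfl⟩
    -- The homogeneous form of `(X - x) g = f`. `N` is nonzero because `x ∉ K` leaves `f` without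
    -- roots in `K`; at `s = 0` it is the leading term `t ^ d`.
    have hNH : N ≠ 0 ∧
        (algebraMap K L t - x * algebraMap K L s) * H =
          algebraMap K L s * algebraMap K L N := by
      simp only [map_mul, map_pow] at hH
      by_cases hs : s = 0
      · have ht : t ≠ 0 := fun h => hst ⟨hs, h⟩
        rw [hs, sum_homogenize_zero, hfd] at hN
        rw [hs, map_zero, sum_homogenize_zero, hgcd] at hH
        exact ⟨by simp [hN, ht], by simp [hH, hs]⟩
      · have hs' : algebraMap K L s ≠ 0 := by simpa using hs
        rw [sum_homogenize f hd.ge hs] at hN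
        rw [sum_homogenize g hgd.le hs'] at hH
        constructor
        · rw [hN]
          refine mul_ne_zero (pow_ne_zero _ hs) fun h => hxK ?_
          rw [hf] at h
          exact ⟨_, minpoly.root hxint h⟩
        · have h1 := congrArg (eval (algebraMap K L (t / s))) hgf
          rw [eval_map_algebraMap, aeval_algebraMap_apply, eval_mul, eval_sub, eval_X, eval_C,
            coe_aeval_eq_eval] at h1
          rw [hN, hH, map_mul, ← h1, map_pow, map_div₀]
          field_simp
    obtain ⟨hN0, hNH⟩ := hNH
    refine ⟨N, hN0, ?_⟩
    rw [he, ← hN, ← hH]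
    have hH' : H = algebraMap K L s * algebraMap K L N /
        (algebraMap K L t - x * algebraMap K L s) := by
      rw [eq_div_iff hden, ← hNH]; ring
    have hd3 : (algebraMap K L s • u + algebraMap K L t • v).2.2 =
        β * (algebraMap K L t - x * algebraMap K L s) := by
      simp only [Prod.snd_add, Prod.smul_snd, smul_eq_mul, hu3, ← hβ]
      ring
    ext
    · change _ = N • ((algebraMap K L s • u + algebraMap K L t • v).1 /
        (algebraMap K L s • u + algebraMap K L t • v).2.2)
      rw [hd3, Algebra.smul_def, hH', hw]
      simp only [Prod.smul_fst, Prod.fst_add, smul_eq_mul]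
      field_simp
      ring
    · change _ = N • ((algebraMap K L s • u + algebraMap K L t • v).2.1 /
        (algebraMap K L s • u + algebraMap K L t • v).2.2)
      rw [hd3, Algebra.smul_def, hH', hw]
      simp only [Prod.smul_fst, Prod.fst_add, Prod.smul_snd, Prod.snd_add, smul_eq_mul]
      field_simp
      ring
    · simp [affineVec]
  refine ⟨d, ?_, ?_, e, hli, ?_⟩
  · rw [hd, hf]; exact (minpoly.two_le_natDegree_iff hxint).2 hxK
  · rw [hd, hf]; exact (minpoly.natDegree_le x).trans hcard
  · ext Q
    rw [mem_abbImage_sublinePoints_iff huv hext]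
    constructor
    · rintro ⟨s, hs, t, ht, hst, rfl⟩
      obtain ⟨s, rfl⟩ := IntermediateField.mem_bot.1 hs
      obtain ⟨t, rfl⟩ := IntermediateField.mem_bot.1 ht
      obtain ⟨N, hN, hsum⟩ := key s t (by simpa using hst)
      refine ⟨s, t, hsum ▸ smul_ne_zero hN (affineVec_ne_zero _), ?_⟩
      rw [eq_comm, affinePoint, mk_eq_mk_iff']
      exact ⟨N, hsum.symm⟩
    · rintro ⟨s, t, h, rfl⟩
      have hst : ¬ (s = 0 ∧ t = 0) := by
        rintro ⟨rfl, rfl⟩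
        refine h (Finset.sum_eq_zero fun i _ => ?_)
        by_cases hi : (i : ℕ) = 0
        · have : d ≠ 0 := by omega
          simp [hi, this]
        · simp [hi]
      obtain ⟨N, hN, hsum⟩ := key s t hst
      refine ⟨_, IntermediateField.algebraMap_mem _ s, _, IntermediateField.algebraMap_mem _ t,
        by simpa using hst, ?_⟩
      rw [affinePoint, mk_eq_mk_iff']
      exact ⟨N, hsum.symm⟩

end RationalCurve

/-! ### Tangent sublines and the subspread -/

section Tangent

variable {K L : Type*} [Field K] [Field L] [Algebra K L] [FiniteDimensional K L]

/-- The affine points of a tangent subline of degree `r` lie in an `r`-space that meets the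
hyperplane at infinity in an element of the subspread. -/
lemma exists_subspace_of_basis_at_infinity (F : IntermediateField K L) {p w : L × L × L}
    (hpw : LinearIndependent L ![p, w]) (hp : p.2.2 = 0) (hw : w.2.2 ≠ 0) :
    ∃ W : Projectivization.Subspace K (L × L × K),
      Module.finrank K W.submodule = Module.finrank K F + 1 ∧
      (∀ s ∈ F, ∀ t ∈ F, t ≠ 0 → affinePoint K (s • p + t • w) ∈ W) ∧
      (W : Set (ℙ K (L × L × K))) ∩ hyperplaneAtInfinity K L ∈
        subspread K L (Module.finrank K F) := by
  obtain ⟨a, ha⟩ : ∃ a, a = p.1 / w.2.2 := ⟨_, rfl⟩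
  obtain ⟨b, hb⟩ : ∃ b, b = p.2.1 / w.2.2 := ⟨_, rfl⟩
  have hab : (a, b) ≠ (0, 0) := by
    intro h
    simp only [ha, hb, Prod.mk.injEq, div_eq_zero_iff, hw, or_false] at h
    refine hpw.ne_zero 0 ?_
    simpa using Prod.ext h.1 (Prod.ext h.2 hp)
  -- Parametrizes the subspace by `z • (p / w₃) + c • (w / w₃)` with `z ∈ F`, `c ∈ K`. The last
  -- coordinate is `c`, so `c = 0` cuts out the subspread element.
  let T : (F × K) →ₗ[K] L × L × K :=
    { toFun := fun z => (a * z.1 + z.2 • (w.1 / w.2.2), b * z.1 + z.2 • (w.2.1 / w.2.2), z.2)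
      map_add' := fun z z' => by
        simp only [Prod.fst_add, Prod.snd_add, IntermediateField.coe_add, Prod.mk_add_mk,
          add_smul]
        ext <;> simp only <;> ring
      map_smul' := fun c z => by
        ext <;> simp [Algebra.smul_def] <;> ring }
  have hT : ∀ (x : F) (c : K), T (x, c) =
      (a * x + c • (w.1 / w.2.2), b * x + c • (w.2.1 / w.2.2), c) := fun _ _ => rfl
  have hinj : Function.Injective T := by
    rw [injective_iff_map_eq_zero]
    rintro ⟨x, c⟩ h
    rw [hT] at h
    simp only [Prod.mk_eq_zero] at h
    obtain ⟨h1, h2, rfl⟩ := h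
    simp only [zero_smul, add_zero, mul_eq_zero] at h1 h2
    have : (x : L) = 0 := by
      by_contra hx
      exact hab (Prod.ext (h1.resolve_right hx) (h2.resolve_right hx))
    ext <;> simp [this]
  refine ⟨(LinearMap.range T).projectivization, ?_, ?_, F, rfl, a, b, hab, ?_⟩
  · rw [Submodule.projectivization, OrderIso.apply_symm_apply, LinearMap.finrank_range_of_inj hinj,
      Module.finrank_prod, Module.finrank_self]
  · intro s hs t ht ht0
    rw [affinePoint, Submodule.mk_mem_projectivization_iff]
    refine ⟨(⟨s / t, div_mem hs ht⟩, 1), ?_⟩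
    rw [hT]
    simp only [affineVec, ha, hb, Prod.fst_add, Prod.snd_add, Prod.smul_fst, Prod.smul_snd,
      smul_eq_mul, hp, mul_zero, zero_add, one_smul]
    ext
    · simp only; field_simp
    · simp only; field_simp
    · rfl
  · ext Q
    constructor
    · rintro ⟨hQ, a', b', h, rfl⟩
      rw [SetLike.mem_coe, Submodule.mk_mem_projectivization_iff] at hQ
      obtain ⟨⟨x, c⟩, hxc⟩ := hQ
      rw [hT] at hxc
      simp only [Prod.mk.injEq] at hxc
      obtain ⟨h1, h2, rfl⟩ := hxc
      simp only [zero_smul, add_zero] at h1 h2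
      subst h1 h2
      exact ⟨x, x.2, h, rfl⟩
    · rintro ⟨x, hx, h, rfl⟩
      refine ⟨?_, _, _, h, rfl⟩
      rw [SetLike.mem_coe, Submodule.mk_mem_projectivization_iff]
      exact ⟨(⟨x, hx⟩, 0), by rw [hT]; simp⟩

end Tangent

end ABB

/-! ### Assembly of the corollary -/

theorem corollary2p7 {K L : Type*} [Field K] [Finite K] [Field L] [Algebra K L]
    [FiniteDimensional K L] (q n k r : ℕ) (hq : Nat.card K = q)
    (hn : Module.finrank K L = n) (hqn : n ≤ q)
    (m : Set (ℙ L (L × L × L))) (hm : ABB.IsSubline K k m) (hext : ABB.IsExternal m)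
    (hr : ABB.SmallestTangentDegree K m r)
    (M : Set (ℙ K (L × L × K))) (hM : M = ABB.abbImage K m) :
    -- `M` consists of `q ^ k + 1` affine points
    (M.ncard = q ^ k + 1 ∧ Disjoint M (ABB.hyperplaneAtInfinity K L)) ∧
    -- no three of which are collinear
    (∀ X ∈ M, ∀ Y ∈ M, ∀ Z ∈ M, X ≠ Y → X ≠ Z → Y ≠ Z →
      ¬ Projectivization.IsCollinear ({X, Y, Z} : Set (ℙ K (L × L × K)))) ∧
    -- and is contained in an `r`-space meeting the hyperplane at infinity in an element of `D_r`
    (∃ W : Projectivization.Subspace K (L × L × K),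
      Module.finrank K W.submodule = r + 1 ∧ M ⊆ W ∧
      (W : Set (ℙ K (L × L × K))) ∩ ABB.hyperplaneAtInfinity K L ∈ ABB.subspread K L r) ∧
    -- any three points of `M` determine a curve `C`, the ABB-image of the one and only
    -- `𝔽_q`-subline whose ABB-image contains them; `C` is an affine normal rational curve
    -- all of whose points belong to `M`
    (∀ X ∈ M, ∀ Y ∈ M, ∀ Z ∈ M, X ≠ Y → X ≠ Z → Y ≠ Z →
      ∃ m₀ : Set (ℙ L (L × L × L)),
        (ABB.IsSubline K 1 m₀ ∧ {X, Y, Z} ⊆ ABB.abbImage K m₀) ∧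
        (∀ m₁, ABB.IsSubline K 1 m₁ → {X, Y, Z} ⊆ ABB.abbImage K m₁ → m₁ = m₀) ∧
        (∃ d, ABB.IsNormalRationalCurve d (ABB.abbImage K m₀)) ∧
        Disjoint (ABB.abbImage K m₀) (ABB.hyperplaneAtInfinity K L) ∧
        ABB.abbImage K m₀ ⊆ M) := by
  obtain ⟨F, hF, u, v, huv, rfl⟩ := hm
  change ABB.IsExternal (ABB.sublinePoints F u v) at hext
  replace hM : M = ABB.abbImage K (ABB.sublinePoints F u v) := hM
  replace hr : ABB.SmallestTangentDegree K (ABB.sublinePoints F u v) r := hr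
  have : Finite L := Module.finite_of_finite K
  have frame : ∀ X ∈ M, ∀ Y ∈ M, ∀ Z ∈ M, X ≠ Y → X ≠ Z → Y ≠ Z →
      ∃ u' v' : L × L × L, ∃ (_ : u' ≠ 0) (_ : v' ≠ 0) (_ : u' + v' ≠ 0),
        LinearIndependent L ![u', v'] ∧
        ABB.sublinePoints F u' v' = ABB.sublinePoints F u v ∧
        X = ABB.affinePoint K u' ∧ Y = ABB.affinePoint K v' ∧
        Z = ABB.affinePoint K (u' + v') := by
    intro X hX Y hY Z hZ hXY hXZ hYZ
    rw [hM] at hX hY hZ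
    simp only [ABB.abbImage, Set.mem_iUnion, exists_prop] at hX hY hZ
    obtain ⟨P₁, hP₁, hX⟩ := hX
    obtain ⟨P₂, hP₂, hY⟩ := hY
    obtain ⟨P₃, hP₃, hZ⟩ := hZ
    have unique : ∀ P ∈ ABB.sublinePoints F u v, ∀ Q Q', Q ∈ ABB.abbMap K P →
        Q' ∈ ABB.abbMap K P → Q = Q' := by
      intro P hP Q Q' hQ hQ'
      induction P using Projectivization.ind with
      | h p hp =>
        have h3 : p.2.2 ≠ 0 := fun h => Set.disjoint_left.1 hext hP
          ((ABB.mk_mem_lineAtInfinity_iff p hp).2 h)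
        rw [ABB.mem_abbMap_mk_iff p h3] at hQ hQ'
        rw [hQ, hQ']
    have h₁₂ : P₁ ≠ P₂ := by rintro rfl; exact hXY (unique _ hP₁ _ _ hX hY)
    have h₁₃ : P₁ ≠ P₃ := by rintro rfl; exact hXZ (unique _ hP₁ _ _ hX hZ)
    have h₂₃ : P₂ ≠ P₃ := by rintro rfl; exact hYZ (unique _ hP₂ _ _ hY hZ)
    obtain ⟨u', v', hu, hv, hw, hli, heq, rfl, rfl, rfl⟩ :=
      ABB.exists_frame huv hP₁ hP₂ hP₃ h₁₂ h₁₃ h₂₃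
    have haff : ∀ (p : L × L × L) (hp : p ≠ 0), Projectivization.mk L p hp ∈ ABB.sublinePoints F u v → p.2.2 ≠ 0 :=
      fun p hp hP h => Set.disjoint_left.1 hext hP ((ABB.mk_mem_lineAtInfinity_iff p hp).2 h)
    exact ⟨u', v', hu, hv, hw, hli, heq,
      (ABB.mem_abbMap_mk_iff _ (haff _ _ hP₁) hu X).1 hX,
      (ABB.mem_abbMap_mk_iff _ (haff _ _ hP₂) hv Y).1 hY,
      (ABB.mem_abbMap_mk_iff _ (haff _ _ hP₃) hw Z).1 hZ⟩
  refine ⟨⟨?_, ?_⟩, ?_, ?_, ?_⟩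
  · rw [hM, ABB.ncard_abbImage_sublinePoints huv hext, Module.natCard_eq_pow_finrank (K := K),
      hq, hF]
  · rw [hM]
    exact ABB.disjoint_abbImage_hyperplaneAtInfinity huv hext
  · intro X hX Y hY Z hZ hXY hXZ hYZ
    obtain ⟨u', v', -, -, -, hli, heq, rfl, rfl, rfl⟩ := frame X hX Y hY Z hZ hXY hXZ hYZ
    exact ABB.not_isCollinear_frame (F := F) hli (heq ▸ hext)
  · obtain ⟨⟨m', ⟨E, rfl, u', v', huv', rfl⟩, ⟨P, ⟨hP, hPinf⟩, -⟩, hsub⟩, -⟩ := hr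
    have hu0 : u ≠ 0 := by simpa using huv.ne_zero 0
    have hQ : Projectivization.mk L u hu0 ∈ ABB.sublinePoints F u v :=
      ⟨1, one_mem F, 0, zero_mem F, by simpa using hu0, by simp⟩
    obtain ⟨p, w, hpw, heq, hp, hw⟩ := ABB.exists_basis_at_infinity huv' hP hPinf (hsub hQ)
      (Set.disjoint_left.1 hext hQ)
    obtain ⟨W, hW, hmem, hinf⟩ := ABB.exists_subspace_of_basis_at_infinity E hpw hp hw
    refine ⟨W, hW, ?_, hinf⟩
    intro X hX
    rw [hM] at hX
    simp only [ABB.abbImage, Set.mem_iUnion, exists_prop] at hX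
    obtain ⟨P', hP', hX⟩ := hX
    have hP'' : P' ∈ ABB.sublinePoints E p w := heq ▸ hsub hP'
    obtain ⟨s, hs, t, ht, h, rfl⟩ := hP''
    have h3 : (s • p + t • w).2.2 ≠ 0 := fun h0 => Set.disjoint_left.1 hext hP'
      ((ABB.mk_mem_lineAtInfinity_iff _ h).2 h0)
    rw [ABB.mem_abbMap_mk_iff _ h3] at hX
    rw [hX]
    -- `t = 0` would give a multiple of `p`, which is at infinity.
    exact hmem s hs t ht (by rintro rfl; simp [hp] at h3)
  · intro X hX Y hY Z hZ hXY hXZ hYZ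
    obtain ⟨u', v', hu, hv, hw, hli, heq, rfl, rfl, rfl⟩ := frame X hX Y hY Z hZ hXY hXZ hYZ
    rw [← heq] at hext hM
    have hle : ABB.sublinePoints (⊥ : IntermediateField K L) u' v' ⊆
        ABB.sublinePoints F u' v' := by
      rintro P ⟨s, hs, t, ht, h, rfl⟩
      exact ⟨s, bot_le (a := F) hs, t, bot_le (a := F) ht, h, rfl⟩
    have hext' : ABB.IsExternal (ABB.sublinePoints (⊥ : IntermediateField K L) u' v') :=
      Set.disjoint_of_subset_left hle hext
    have hu3 : u'.2.2 ≠ 0 := by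
      simpa using hext.combination_ne_zero hli (one_mem F) (zero_mem F) (by simp)
    have hv3 : v'.2.2 ≠ 0 := by
      simpa using hext.combination_ne_zero hli (zero_mem F) (one_mem F) (by simp)
    have hw3 : (u' + v').2.2 ≠ 0 := by
      simpa using hext.combination_ne_zero hli (one_mem F) (one_mem F) (by simp)
    -- The `K`-span of the frame of the three points; it inherits externality from the larger
    -- subline.
    refine ⟨ABB.sublinePoints ⊥ u' v', ⟨⟨⊥, IntermediateField.finrank_bot, u', v', hli, rfl⟩, ?_⟩,
      ?_, ABB.isNormalRationalCurve_abbImage (by rw [hn, hq]; exact hqn) hli hext',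
      ABB.disjoint_abbImage_hyperplaneAtInfinity hli hext', ?_⟩
    · intro Q hQ
      rw [ABB.mem_abbImage_sublinePoints_iff hli hext']
      rcases hQ with rfl | rfl | rfl
      · exact ⟨1, one_mem _, 0, zero_mem _, by simp, by simp⟩
      · exact ⟨0, zero_mem _, 1, one_mem _, by simp, by simp⟩
      · exact ⟨1, one_mem _, 1, one_mem _, by simp, by simp⟩
    · rintro m₁ ⟨F₁, hF₁, u₁, v₁, huv₁, rfl⟩ hsub
      -- Only the base field has degree one, so any competing subline is over the same field and
      -- shares the frame.
      obtain rfl : F₁ = ⊥ := IntermediateField.finrank_eq_one_iff.1 hF₁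
      change {_, _, _} ⊆ ABB.abbImage K (ABB.sublinePoints ⊥ u₁ v₁) at hsub
      have hmem : ∀ (p : L × L × L) (hp : p ≠ 0), p.2.2 ≠ 0 →
          ABB.affinePoint K p ∈
            ABB.abbImage K (ABB.sublinePoints (⊥ : IntermediateField K L) u₁ v₁) →
          Projectivization.mk L p hp ∈
            ABB.sublinePoints (⊥ : IntermediateField K L) u₁ v₁ := by
        intro p hp h3 h
        simp only [ABB.abbImage, Set.mem_iUnion, exists_prop] at h
        obtain ⟨P, hP, h⟩ := h
        rwa [ABB.eq_mk_of_affinePoint_mem_abbMap h3 hp h] at hP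
      obtain ⟨u₂, v₂, hu₂, hv₂, hw₂, -, heq₂, e₁, e₂, e₃⟩ := ABB.exists_frame huv₁
        (hmem u' hu hu3 (hsub (by simp))) (hmem v' hv hv3 (hsub (by simp)))
        (hmem (u' + v') hw hw3 (hsub (by simp)))
        (fun h => hXY ((ABB.affinePoint_eq_iff hu3 hv3 hu hv).2 h))
        (fun h => hXZ ((ABB.affinePoint_eq_iff hu3 hw3 hu hw).2 h))
        (fun h => hYZ ((ABB.affinePoint_eq_iff hv3 hw3 hv hw).2 h))
      exact heq₂.symm.trans (ABB.sublinePoints_eq_of_frame hli hu hv hw hu₂ hv₂ hw₂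
        e₁.symm e₂.symm e₃.symm)
    · rw [hM]
      exact Set.biUnion_subset_biUnion_left hle
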